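/- Let $(\Gamma,+,0,\le)$ be a divisible totally ordered abelian group (possibly trivial). Let $\mathbb{T}_{\max}=\Gamma\cup\{\bot\}$ be the tropical semifield, with $a\oplus b=\max(a,b)$, $a\odot b=a+b$ and zero element $\bot$. Let $\mathbb{S}_{\max}$ be the symmetrized tropical semiring, that is the quotient of $\mathbb{T}_{\max}^2$, with operations $(a_1,a_2)\oplus(b_1,b_2)=(a_1\oplus b_1,a_2\oplus b_2)$ and $(a_1,a_2)\odot(b_1,b_2)=(a_1b_1\oplus a_2b_2,\,a_1b_2\oplus a_2b_1)$, by the congruence that identifies $(a_1,a_2)$ and $(b_1,b_2)$ if they are equal, or if $a_1\ne a_2$, $b_1\neq b_2$ and $a_1\oplus b_2=a_2\oplus b_1$. On classes put $\ominus(a_1,a_2)=(a_2,a_1)$, $|(a_1,a_2)|=a_1\oplus a_2\in\mathbb{T}_{\max}$, and $(a_1,a_2)\,\nabla\,(b_1,b_2)$ iff $a_1\oplus b_2=a_2\oplus b_1$. Let $\mathbb{S}_{\max}^\vee$ be the set of signed elements, that is the classes of $(c,\bot)$ and $(\bot,c)$ with $c\in\mathbb{T}_{\max}$. The relation $\nabla$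 and the map $|\cdot|$ are applied to formal polynomials coefficientwise. For a formal polynomial $P$ with coefficients in $\mathbb{S}_{\max}^\vee$, a root of $P$ is an $r\in\mathbb{S}_{\max}^\vee$ with $\widehat P(r)\,\nabla\,\mathbb{0}$, where $\widehat P$ is the polynomial function of $P$. For nonzero $P$ and $r\in\mathbb{S}_{\max}^\vee$, the multiplicity $\mathrm{mult}_r(P)$ is $0$ if $r$ is not a root of $P$, and otherwise $$\mathrm{mult}_r(P)=1+\max\{\mathrm{mult}_r(Q)\mid Q\in\mathbb{S}_{\max}^\vee[\mathsf Y],\ \lambda\in\mathbb{S}_{\max}^\vee\setminus\{\mathbb{0}\},\ \lambda P\,\nabla\,(\mathsf Y\ominus r)Q\}.$$ For a nonzero formal polynomial $p=\bigoplus_k p_k\mathsf Y^k$ over $\mathbb{T}_{\max}$, an element $c\neq\bot$ is a corner of $p$ if the maximum $\max_k(p_k+kc)$ is attained by at least two monomials, and its multiplicity is the largest minus the smallest exponent attaining it; $\bot$ is a corner of $p$ if $p_0=\bot$, and its multiplicity is the smallest exponent $k$ with $p_k\ne\bot$. Let $P$ be a formal polynomial of degree $n\ge 0$ (in particular $P\neq\mathbb{0}$)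 with coefficients in $\mathbb{S}_{\max}^\vee$. Then: 1. for every root $r\in\mathbb{S}_{\max}^\vee$ of $P$, $|r|$ is a corner of $|P|$, and $\mathrm{mult}_r(P)$ is at most the multiplicity of $|r|$ as a corner of $|P|$; 2. for every root $r\neq\mathbb{0}$ of $P$, $\mathrm{mult}_r(P)+\mathrm{mult}_{\ominus r}(P)$ is at most the multiplicity of $|r|$ as a corner of $|P|$; 3. $P$ has at most $n$ roots counted with multiplicity: the set of its roots in $\mathbb{S}_{\max}^\vee$ is finite and $\sum_{r}\mathrm{mult}_r(P)\le n$, the sum being over all roots $r$ of $P$. -/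

import Mathlib

open Polynomial

set_option linter.unusedSectionVars false

/-! ### The tropical semifield over an ordered abelian group -/

/-- The tropical (max-plus) semifield `Γ ∪ {⊥}` over a totally ordered abelian group `Γ`:
addition is the maximum, multiplication is the addition of `Γ`, with `⊥` absorbing. -/
def TMax (Γ : Type*) : Type _ := WithBot Γ

namespace TMax

variable {Γ : Type*} [AddCommGroup Γ] [LinearOrder Γ] [IsOrderedAddMonoid Γ]

noncomputable instance : LinearOrder (TMax Γ) := inferInstanceAs (LinearOrder (WithBot Γ))

/-- The element of `TMax Γ` given by an element of `Γ ∪ {⊥}`. -/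
def of (a : WithBot Γ) : TMax Γ := a

/-- The element of `Γ ∪ {⊥}` underlying an element of `TMax Γ`. -/
def val (a : TMax Γ) : WithBot Γ := a

noncomputable instance : Add (TMax Γ) := ⟨fun a b => max a b⟩
noncomputable instance : Mul (TMax Γ) := ⟨fun a b => of (a.val + b.val)⟩
instance : Zero (TMax Γ) := ⟨of ⊥⟩
instance : One (TMax Γ) := ⟨of 0⟩

noncomputable instance : CommSemiring (TMax Γ) where
  nsmul := nsmulRec
  npow := npowRec
  add_assoc a b c := max_assoc a b c
  zero_add a := max_eq_right (bot_le (α := WithBot Γ) (a := a))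
  add_zero a := max_eq_left (bot_le (α := WithBot Γ) (a := a))
  add_comm a b := max_comm a b
  left_distrib a b c := (max_add_add_left a.val b.val c.val).symm
  right_distrib a b c := (max_add_add_right a.val b.val c.val).symm
  zero_mul a := WithBot.bot_add a.val
  mul_zero a := WithBot.add_bot a.val
  mul_assoc a b c := add_assoc a.val b.val c.val
  one_mul a := zero_add a.val
  mul_one a := add_zero a.val
  mul_comm a b := add_comm a.val b.val

theorem add_eq_max (a b : TMax Γ) : a + b = max a b := rfl

theorem zero_le (a : TMax Γ) : 0 ≤ a := bot_le (α := WithBot Γ) (a := a)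

theorem mul_lt_mul_right_of_ne {a b c : TMax Γ} (hc : c ≠ 0) (h : a < b) : a * c < b * c :=
  WithBot.add_lt_add_right (α := Γ) (x := a.val) (y := b.val) (z := c.val) hc h

theorem mul_le_mul_right_of_le {a b : TMax Γ} (c : TMax Γ) (h : a ≤ b) : a * c ≤ b * c := by
  rw [← max_eq_right h, ← add_eq_max, add_mul, add_eq_max]
  exact le_max_left _ _

end TMax

/-! ### The symmetrized tropical semiring -/

/-- Pairs of elements of `TMax Γ`. -/
@[ext] structure TPair (Γ : Type*) where
  fst : TMax Γ
  snd : TMax Γ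

namespace TPair

variable {Γ : Type*} [AddCommGroup Γ] [LinearOrder Γ] [IsOrderedAddMonoid Γ]

noncomputable instance : Add (TPair Γ) := ⟨fun a b => ⟨a.fst + b.fst, a.snd + b.snd⟩⟩
noncomputable instance : Mul (TPair Γ) :=
  ⟨fun a b => ⟨a.fst * b.fst + a.snd * b.snd, a.fst * b.snd + a.snd * b.fst⟩⟩
noncomputable instance : Zero (TPair Γ) := ⟨⟨0, 0⟩⟩
noncomputable instance : One (TPair Γ) := ⟨⟨1, 0⟩⟩

@[simp] theorem add_fst (a b : TPair Γ) : (a + b).fst = a.fst + b.fst := rfl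
@[simp] theorem add_snd (a b : TPair Γ) : (a + b).snd = a.snd + b.snd := rfl
@[simp] theorem mul_fst (a b : TPair Γ) : (a * b).fst = a.fst * b.fst + a.snd * b.snd := rfl
@[simp] theorem mul_snd (a b : TPair Γ) : (a * b).snd = a.fst * b.snd + a.snd * b.fst := rfl
@[simp] theorem zero_fst : (0 : TPair Γ).fst = 0 := rfl
@[simp] theorem zero_snd : (0 : TPair Γ).snd = 0 := rfl
@[simp] theorem one_fst : (1 : TPair Γ).fst = 1 := rfl
@[simp] theorem one_snd : (1 : TPair Γ).snd = 0 := rfl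

noncomputable instance : CommSemiring (TPair Γ) where
  nsmul := nsmulRec
  npow := npowRec
  add_assoc a b c := by ext <;> simp [add_assoc]
  zero_add a := by ext <;> simp
  add_zero a := by ext <;> simp
  add_comm a b := by ext <;> simp [add_comm]
  left_distrib a b c := by ext <;> simp <;> ring
  right_distrib a b c := by ext <;> simp <;> ring
  zero_mul a := by ext <;> simp
  mul_zero a := by ext <;> simp
  mul_assoc a b c := by ext <;> simp <;> ring
  one_mul a := by ext <;> simp
  mul_one a := by ext <;> simp
  mul_comm a b := by ext <;> simp <;> ring

/-- The minus operator `⊖ (a₁, a₂) = (a₂, a₁)`. -/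
def neg (a : TPair Γ) : TPair Γ := ⟨a.snd, a.fst⟩

/-- The absolute value `|(a₁, a₂)| = a₁ ⊕ a₂`. -/
noncomputable def abs (a : TPair Γ) : TMax Γ := a.fst + a.snd

/-- The balance relation `a₁ ⊕ b₂ = a₂ ⊕ b₁` on pairs. -/
def Balances (a b : TPair Γ) : Prop := a.fst + b.snd = a.snd + b.fst

/-- The equivalence relation whose quotient is the symmetrized tropical semiring. -/
def Rel (a b : TPair Γ) : Prop :=
  (a.fst ≠ a.snd ∧ b.fst ≠ b.snd ∧ a.fst + b.snd = a.snd + b.fst) ∨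
    (¬ (a.fst ≠ a.snd ∧ b.fst ≠ b.snd) ∧ a = b)

theorem rel_iff (a b : TPair Γ) : Rel a b ↔ a = b ∨
    (a.fst < a.snd ∧ b.fst < b.snd ∧ a.snd = b.snd) ∨
    (a.snd < a.fst ∧ b.snd < b.fst ∧ a.fst = b.fst) := by
  obtain ⟨a1, a2⟩ := a
  obtain ⟨b1, b2⟩ := b
  simp only [Rel, TMax.add_eq_max, TPair.mk.injEq]
  grind

theorem rel_equivalence : Equivalence (Rel (Γ := Γ)) where
  refl a := by rw [rel_iff]; exact Or.inl rfl
  symm := by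
    intro a b
    simp only [rel_iff, TPair.ext_iff]
    grind
  trans := by
    intro a b c
    simp only [rel_iff, TPair.ext_iff]
    grind

theorem Rel.neg {a b : TPair Γ} (h : Rel a b) : Rel a.neg b.neg := by
  simp only [rel_iff, TPair.ext_iff, TPair.neg] at h ⊢
  grind

theorem Rel.abs {a b : TPair Γ} (h : Rel a b) : a.abs = b.abs := by
  simp only [rel_iff, TPair.ext_iff, TPair.abs, TMax.add_eq_max] at h ⊢
  grind

theorem Rel.balances {a a' b b' : TPair Γ} (h : Rel a a') (h' : Rel b b') :
    Balances a b ↔ Balances a' b' := by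
  simp only [rel_iff, TPair.ext_iff, Balances, TMax.add_eq_max] at h h' ⊢
  grind

theorem Rel.add_right {a b : TPair Γ} (h : Rel a b) (c : TPair Γ) : Rel (a + c) (b + c) := by
  simp only [rel_iff, TPair.ext_iff, add_fst, add_snd, TMax.add_eq_max] at h ⊢
  grind

theorem rel_mul_aux {a b c : TPair Γ} (ha : a.fst < a.snd) (hb : b.fst < b.snd)
    (hab : a.snd = b.snd) : Rel (a * c) (b * c) := by
  obtain ⟨a1, a2⟩ := a
  obtain ⟨b1, b2⟩ := b
  obtain ⟨c1, c2⟩ := c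
  simp only at ha hb hab
  subst hab
  have ha2 : a2 ≠ 0 := ((TMax.zero_le a1).trans_lt ha).ne'
  have lt_mul : ∀ x y z : TMax Γ, x < y → z ≠ 0 → x * z < y * z :=
    fun x y z h hz => TMax.mul_lt_mul_right_of_ne hz h
  have le_mul : ∀ x y z : TMax Γ, x ≤ y → x * z ≤ y * z :=
    fun x y z h => TMax.mul_le_mul_right_of_le z h
  simp only [rel_iff, TPair.ext_iff, mul_fst, mul_snd, TMax.add_eq_max]
  rcases lt_trichotomy c1 c2 with hc | hc | hc
  · have h0 : c2 ≠ 0 := ((TMax.zero_le c1).trans_lt hc).ne'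
    have h1 := lt_mul _ _ _ ha h0
    have h2 := lt_mul _ _ _ hb h0
    have h3 := lt_mul _ _ _ hc ha2
    have h4 := le_mul _ _ c1 ha.le
    have h5 := le_mul _ _ c1 hb.le
    rw [mul_comm c1, mul_comm c2] at h3
    grind
  · subst hc
    have h4 := le_mul _ _ c1 ha.le
    have h5 := le_mul _ _ c1 hb.le
    grind
  · have h0 : c1 ≠ 0 := ((TMax.zero_le c2).trans_lt hc).ne'
    have h1 := lt_mul _ _ _ ha h0
    have h2 := lt_mul _ _ _ hb h0
    have h3 := lt_mul _ _ _ hc ha2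
    have h4 := le_mul _ _ c2 ha.le
    have h5 := le_mul _ _ c2 hb.le
    rw [mul_comm c1, mul_comm c2] at h3
    grind

theorem Rel.mul_right {a b : TPair Γ} (h : Rel a b) (c : TPair Γ) : Rel (a * c) (b * c) := by
  rcases (rel_iff a b).1 h with h | ⟨h1, h2, h3⟩ | ⟨h1, h2, h3⟩
  · rw [h]; exact rel_equivalence.refl _
  · exact rel_mul_aux h1 h2 h3
  · have := (rel_mul_aux (a := a.neg) (b := b.neg) (c := c) h1 h2 h3).neg
    have e : ∀ x : TPair Γ, (x.neg * c).neg = x * c := fun x => by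
      ext <;> simp [TPair.neg, add_comm]
    rwa [e, e] at this

theorem abs_add (a b : TPair Γ) : (a + b).abs = a.abs + b.abs := by
  simp only [TPair.abs, add_fst, add_snd]; ring

theorem abs_mul (a b : TPair Γ) : (a * b).abs = a.abs * b.abs := by
  simp only [TPair.abs, mul_fst, mul_snd]; ring

end TPair

/-- The relation `TPair.Rel` as a congruence of the semiring of pairs. -/
def TPair.con (Γ : Type*) [AddCommGroup Γ] [LinearOrder Γ] [IsOrderedAddMonoid Γ] :
    RingCon (TPair Γ) where
  r := TPair.Rel
  iseqv := TPair.rel_equivalence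
  add' {a b c d} h h' := by
    have h1 := h'.add_right b
    rw [add_comm c, add_comm d] at h1
    exact TPair.rel_equivalence.trans (h.add_right c) h1
  mul' {a b c d} h h' := by
    have h1 := h'.mul_right b
    rw [mul_comm c, mul_comm d] at h1
    exact TPair.rel_equivalence.trans (h.mul_right c) h1

/-- The symmetrized tropical semiring over `Γ`. -/
def SMax (Γ : Type*) [AddCommGroup Γ] [LinearOrder Γ] [IsOrderedAddMonoid Γ] : Type _ :=
  (TPair.con Γ).Quotient

namespace SMax

variable {Γ : Type*} [AddCommGroup Γ] [LinearOrder Γ] [IsOrderedAddMonoid Γ]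

noncomputable instance : CommSemiring (SMax Γ) :=
  inferInstanceAs (CommSemiring (TPair.con Γ).Quotient)

/-- The class of a pair, as a morphism of semirings. -/
noncomputable def mk : TPair Γ →+* SMax Γ := (TPair.con Γ).mk'

/-- The minus operator `⊖` of the symmetrized tropical semiring. -/
def neg : SMax Γ → SMax Γ := Quotient.map TPair.neg fun _ _ h => TPair.Rel.neg h

/-- The absolute value, a morphism of semirings to `TMax Γ`. -/
noncomputable def abs : SMax Γ →+* TMax Γ where
  toFun := Quotient.lift TPair.abs fun _ _ h => TPair.Rel.abs h
  map_one' := by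
    change TPair.abs (1 : TPair Γ) = 1
    simp [TPair.abs]
  map_zero' := by
    change TPair.abs (0 : TPair Γ) = 0
    simp [TPair.abs]
  map_add' a b := by
    induction a, b using Quotient.inductionOn₂ with
    | h a b => exact TPair.abs_add a b
  map_mul' a b := by
    induction a, b using Quotient.inductionOn₂ with
    | h a b => exact TPair.abs_mul a b

/-- The balance relation `∇` of the symmetrized tropical semiring. -/
def Balances : SMax Γ → SMax Γ → Prop :=
  Quotient.lift₂ TPair.Balances fun _ _ _ _ h h' => propext (TPair.Rel.balances h h')

/-- Signed elements: the classes of `(c, ⊥)` (positive or zero) and of `(⊥, c)`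
(negative or zero). -/
def IsSigned (a : SMax Γ) : Prop := ∃ c : TMax Γ, a = mk ⟨c, 0⟩ ∨ a = mk ⟨0, c⟩

/-- Formal polynomials all of whose coefficients are signed. -/
def IsSignedPoly (P : (SMax Γ)[X]) : Prop := ∀ k, IsSigned (P.coeff k)

/-- `r` is a (signed) root of `P`: it is signed and the value of `P` at `r` balances zero. -/
def IsSignedRoot (P : (SMax Γ)[X]) (r : SMax Γ) : Prop :=
  IsSigned r ∧ Balances (P.eval r) 0

/-- `Q` is obtained from `P` by dividing out the linear factor `Y ⊖ a` up to balance: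
`Q` has signed coefficients and `lam P ∇ (Y ⊖ a) Q`, coefficient by coefficient, for some
nonzero signed `lam`. -/
def IsQuotient (a : SMax Γ) (P Q : (SMax Γ)[X]) : Prop :=
  IsSignedPoly Q ∧ ∃ lam : SMax Γ, IsSigned lam ∧ lam ≠ 0 ∧
    ∀ k, Balances ((C lam * P).coeff k) (((X + C (neg a)) * Q).coeff k)

open Classical in
/-- The right-hand side of the recursion that defines the multiplicity of a root. -/
noncomputable def multStep (a : SMax Γ) : ((SMax Γ)[X] → ℕ∞) →o ((SMax Γ)[X] → ℕ∞) where
  toFun m P := if IsSignedRoot P a then 1 + ⨆ Q : {Q // IsQuotient a P Q}, m Q else 0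
  monotone' m m' h P := by
    dsimp only
    split_ifs
    · exact add_le_add le_rfl (iSup_mono fun Q => h Q)
    · exact le_rfl

/-- The multiplicity `mult_a(P)`: the function given by the recursion `rootMult_eq` below.
(A quotient of a nonzero `P` has degree `deg P - 1`, so for `P ≠ 0` the recursion determines the
value; for the zero polynomial, of which zero is a quotient, the value is `⊤`.) -/
noncomputable def rootMult (a : SMax Γ) : (SMax Γ)[X] → ℕ∞ := (multStep a).lfp

open Classical in
/-- `mult_a(P) = 0` if `a` is not a root of `P`, and otherwise `mult_a(P)` is one plus the
largest `mult_a(Q)` with `lam P ∇ (Y ⊖ a) Q`. -/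
theorem rootMult_eq (a : SMax Γ) (P : (SMax Γ)[X]) :
    rootMult a P =
      if IsSignedRoot P a then 1 + ⨆ Q : {Q // IsQuotient a P Q}, rootMult a Q else 0 :=
  (congrFun (multStep a).map_lfp P).symm

end SMax

/-! ### Corners of tropical polynomials -/

namespace TMax

variable {Γ : Type*} [AddCommGroup Γ] [LinearOrder Γ] [IsOrderedAddMonoid Γ]

/-- The exponents of the monomials of `p` that attain the maximum `p(c) = max_k (p_k + k c)`. -/
noncomputable def maxExponents (p : (TMax Γ)[X]) (c : TMax Γ) : Finset ℕ :=
  p.support.filter fun k => p.coeff k * c ^ k = p.eval c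

open Classical in
/-- A nonzero `c` is a corner of `p` if at least two monomials attain the maximum at `c`; zero is
a corner if `p` has no constant term. -/
def IsCorner (p : (TMax Γ)[X]) (c : TMax Γ) : Prop :=
  if c = 0 then p.coeff 0 = 0 else 2 ≤ (maxExponents p c).card

open Classical in
/-- The multiplicity of a corner `c` of `p`: the lower degree of `p` if `c` is zero, and the
largest minus the smallest exponent attaining the maximum at `c` otherwise. -/
noncomputable def cornerMult (p : (TMax Γ)[X]) (c : TMax Γ) : ℕ :=
  if c = 0 then p.natTrailingDegree
  else sSup (maxExponents p c : Set ℕ) - sInf (maxExponents p c : Set ℕ)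

end TMax

/-! The proof is a tropical Descartes rule of signs. For a root `r ≠ 0`, keep only the monomials of
`P` that attain the maximum of `|P|` at `|r|`. Let `variation r P` be the number of sign changes of
their values at `r`. Three facts give the bounds.

A root needs maximal terms of both signs, so `variation r P ≥ 1` (`one_le_variation`). If `lam P ∇
(Y ⊖ r) Q`, the maximal terms of `P` have, up to a global sign, the signs of consecutive differences
of the terms of `Q`, and such differencing creates a sign change (`signScan_diff`,
`IsQuotient.variation_lt`). As the multiplicity is a least fixed point, it is at most the variation
(`rootMult_le_of_quotient`). Finally, replacing `r` by `⊖ r` alternates the signs, and the sign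
changes of a sequence and of its alternation together number at most the length of the supporting
interval (`signScan_add_alternating_le`). Here that length is the corner multiplicity.

For `r = 0` the lower degree plays the role of the variation. The global count holds because the
exponent intervals of distinct corners are disjoint in `[0, n)` (`sum_cornerMult_le`), and each
absolute value is carried by at most two signed elements, `r` and `⊖ r`. -/

/-! ### Sign variations -/

/-- One step of the automaton that counts the sign changes of a sequence: the state holds the last
nonzero sign and the number of sign changes. -/
def signStep (s : SignType × ℕ) (x : SignType) : SignType × ℕ :=
  if x = 0 then s else if s.1 ≠ 0 ∧ s.1 ≠ x then (x, s.2 + 1) else (x, s.2)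

/-- The last nonzero sign and the number of sign changes among the first `n` terms. -/
def signScan (α : ℕ → SignType) : ℕ → SignType × ℕ
  | 0 => (0, 0)
  | n + 1 => signStep (signScan α n) (α n)

/-- The possible signs of `q' - q + (smaller terms)`, given the signs of `q'` and `q`. -/
def SignDiff (x y a : SignType) : Prop :=
  (x = 0 → a = -y) ∧ (y ≠ x → x ≠ 0 → a = x)

theorem signScan_eq_of_zero {α : ℕ → SignType} {m n : ℕ} (hmn : m ≤ n)
    (h : ∀ k, m ≤ k → α k = 0) : signScan α n = signScan α m := by
  induction n, hmn using Nat.le_induction with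
  | base => rfl
  | succ n hn ih => simp [signScan, signStep, h n hn, ih]

theorem signScan_zero {α : ℕ → SignType} {n : ℕ} (h : ∀ k < n, α k = 0) :
    signScan α n = (0, 0) := by
  induction n with
  | zero => rfl
  | succ n ih =>
    simp [signScan, signStep, h n n.lt_succ_self, ih fun k hk => h k (hk.trans n.lt_succ_self)]

theorem eq_of_signScan_eq_zero {α : ℕ → SignType} (n : ℕ) (h : (signScan α n).2 = 0) :
    ∀ k < n, α k = 0 ∨ α k = (signScan α n).1 := by
  induction n with
  | zero => simp
  | succ n ih =>
    intro k hk
    simp only [signScan, signStep] at h ⊢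
    grind

theorem signScan_fst_ne_zero {α : ℕ → SignType} {n k : ℕ} (hk : k < n) (h : α k ≠ 0) :
    (signScan α n).1 ≠ 0 := by
  induction n with
  | zero => simp at hk
  | succ n ih =>
    simp only [signScan, signStep]
    grind

/-- A global nonzero sign changes no comparison of consecutive signs; this absorbs the factors `lam`
and `r` in `IsQuotient.variation_lt`. -/
theorem signScan_mul {α : ℕ → SignType} {s : SignType} (hs : s ≠ 0) (n : ℕ) :
    signScan (fun k => s * α k) n = (s * (signScan α n).1, (signScan α n).2) := by
  induction n with
  | zero => simp [signScan]
  | succ n ih =>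
    simp only [signScan, ih, signStep]
    obtain ⟨t, v⟩ := signScan α n
    generalize α n = x
    clear ih
    rcases SignType.trichotomy s with rfl | rfl | rfl <;>
      rcases SignType.trichotomy x with rfl | rfl | rfl <;>
      rcases SignType.trichotomy t with rfl | rfl | rfl <;> simp +decide at hs ⊢

/-- Induction step for `signScan_diff`. Here `(t, v)` scans the quotient, `(s, u)` its differences,
and `x` is the current quotient sign. Either nothing has been seen, or the last signs are opposite,
or they agree and the differences are already one change ahead. Whenever the quotient stops at `t`
or changes sign, the difference takes the sign `t`, which costs a change if `s = -t`. -/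
theorem signStep_diff {x y a s t : SignType} {u v : ℕ} (h : SignDiff x y a)
    (hi : (t = 0 ∧ s = 0 ∧ x = 0 ∧ v ≤ u) ∨ (t ≠ 0 ∧ s = -t ∧ x = t ∧ v ≤ u) ∨
      (t ≠ 0 ∧ s = t ∧ (x = 0 ∨ x = t) ∧ v + 1 ≤ u)) :
    ((signStep (t, v) y).1 = 0 ∧ (signStep (s, u) a).1 = 0 ∧ y = 0 ∧
      (signStep (t, v) y).2 ≤ (signStep (s, u) a).2) ∨
    ((signStep (t, v) y).1 ≠ 0 ∧ (signStep (s, u) a).1 = -(signStep (t, v) y).1 ∧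
      y = (signStep (t, v) y).1 ∧ (signStep (t, v) y).2 ≤ (signStep (s, u) a).2) ∨
    ((signStep (t, v) y).1 ≠ 0 ∧ (signStep (s, u) a).1 = (signStep (t, v) y).1 ∧
      (y = 0 ∨ y = (signStep (t, v) y).1) ∧
      (signStep (t, v) y).2 + 1 ≤ (signStep (s, u) a).2) := by
  obtain ⟨h1, h2⟩ := h
  simp only [signStep]
  rcases SignType.trichotomy x with rfl | rfl | rfl <;>
    rcases SignType.trichotomy s with rfl | rfl | rfl <;>
    rcases SignType.trichotomy t with rfl | rfl | rfl <;>
    rcases SignType.trichotomy y with rfl | rfl | rfl <;>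
    rcases SignType.trichotomy a with rfl | rfl | rfl <;>
    simp +decide at h1 h2 hi ⊢ <;> omega

/-- Descartes' rule for one factor: multiplication by `Y - 1` creates a sign change. -/
theorem signScan_diff {α κ : ℕ → SignType} (h0 : SignDiff 0 (κ 0) (α 0))
    (h : ∀ k, SignDiff (κ k) (κ (k + 1)) (α (k + 1))) {n k : ℕ} (hk : k < n + 1) (hk' : κ k ≠ 0)
    (hn : κ n = 0) : (signScan κ (n + 1)).2 + 1 ≤ (signScan α (n + 1)).2 := by
  have key : ∀ n, ((signScan κ (n + 1)).1 = 0 ∧ (signScan α (n + 1)).1 = 0 ∧ κ n = 0 ∧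
        (signScan κ (n + 1)).2 ≤ (signScan α (n + 1)).2) ∨
      ((signScan κ (n + 1)).1 ≠ 0 ∧ (signScan α (n + 1)).1 = -(signScan κ (n + 1)).1 ∧
        κ n = (signScan κ (n + 1)).1 ∧ (signScan κ (n + 1)).2 ≤ (signScan α (n + 1)).2) ∨
      ((signScan κ (n + 1)).1 ≠ 0 ∧ (signScan α (n + 1)).1 = (signScan κ (n + 1)).1 ∧
        (κ n = 0 ∨ κ n = (signScan κ (n + 1)).1) ∧
        (signScan κ (n + 1)).2 + 1 ≤ (signScan α (n + 1)).2) := by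
    intro n
    induction n with
    | zero => exact signStep_diff h0 (Or.inl ⟨rfl, rfl, rfl, le_rfl⟩)
    | succ n ih => exact signStep_diff (h n) ih
  -- A nonzero term excludes the first alternative, and `κ n = 0` excludes the second, where `κ n`
  -- is the last nonzero sign.
  have := signScan_fst_ne_zero hk hk'
  grind

/-- With `e` the parity sign of the current index, a nonzero `x` following a nonzero term directly
changes sign in exactly one of the two sequences. After a gap it may change both or neither; the
second alternative stores the spare unit that pays for a double change. -/
theorem signStep_alternating {x e s t : SignType} {u v m : ℕ} (he : e = 1 ∨ e = -1)
    (hi : (s ≠ 0 ∧ t = e * s ∧ u + v ≤ m) ∨ (s ≠ 0 ∧ t = -(e * s) ∧ u + v + 1 ≤ m)) :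
    ((signStep (s, u) x).1 ≠ 0 ∧ (signStep (t, v) (-e * x)).1 = -e * (signStep (s, u) x).1 ∧
      (signStep (s, u) x).2 + (signStep (t, v) (-e * x)).2 ≤ m + 1) ∨
    ((signStep (s, u) x).1 ≠ 0 ∧ (signStep (t, v) (-e * x)).1 = -(-e * (signStep (s, u) x).1) ∧
      (signStep (s, u) x).2 + (signStep (t, v) (-e * x)).2 + 1 ≤ m + 1) := by
  simp only [signStep]
  rcases he with rfl | rfl <;>
    rcases SignType.trichotomy x with rfl | rfl | rfl <;>
    rcases SignType.trichotomy s with rfl | rfl | rfl <;>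
    rcases SignType.trichotomy t with rfl | rfl | rfl <;>
    simp +decide at hi ⊢ <;> omega

/-- The sign changes of a sequence and of its alternation are at most as many as the length of an
interval that contains its support. -/
theorem signScan_add_alternating_le {α : ℕ → SignType} {f : ℕ} (hf : ∀ k < f, α k = 0)
    (hf' : α f ≠ 0) (m : ℕ) :
    (signScan α (f + m + 1)).2 + (signScan (fun k => (-1) ^ k * α k) (f + m + 1)).2 ≤ m := by
  have hpow : ∀ k, ((-1) ^ k : SignType) = 1 ∨ ((-1) ^ k : SignType) = -1 := by
    intro k
    induction k with
    | zero => simp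
    | succ k ih => rcases ih with h | h <;> simp [pow_succ, h]
  have key : ((signScan α (f + m + 1)).1 ≠ 0 ∧
      (signScan (fun k => (-1) ^ k * α k) (f + m + 1)).1 =
        (-1) ^ (f + m) * (signScan α (f + m + 1)).1 ∧
      (signScan α (f + m + 1)).2 + (signScan (fun k => (-1) ^ k * α k) (f + m + 1)).2 ≤ m) ∨
    ((signScan α (f + m + 1)).1 ≠ 0 ∧
      (signScan (fun k => (-1) ^ k * α k) (f + m + 1)).1 =
        -((-1) ^ (f + m) * (signScan α (f + m + 1)).1) ∧
      (signScan α (f + m + 1)).2 + (signScan (fun k => (-1) ^ k * α k) (f + m + 1)).2 + 1 ≤ m) := by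
    induction m with
    -- Both scans start at the first nonzero term, so no sign change has occurred there.
    | zero =>
      have h1 := signScan_zero hf
      have h2 : signScan (fun k => (-1) ^ k * α k) f = (0, 0) :=
        signScan_zero fun k hk => by simp [hf k hk]
      rcases hpow f with h | h <;> simp [signScan, h1, h2, signStep, hf', h]
    | succ m ih =>
      have e : ((-1) ^ (f + (m + 1)) : SignType) = -(-1) ^ (f + m) := by
        rw [← add_assoc, pow_succ]; simp
      have := signStep_alternating (x := α (f + (m + 1))) (hpow (f + m)) ih
      rw [e]
      simp only [← e] at this ⊢
      exact this
  rcases key with h | h <;> omega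

/-! ### Tropical polynomials -/

namespace TMax

variable {Γ : Type*} [AddCommGroup Γ] [LinearOrder Γ] [IsOrderedAddMonoid Γ]

theorem mul_ne_zero' {a b : TMax Γ} (ha : a ≠ 0) (hb : b ≠ 0) : a * b ≠ 0 := by
  have h := mul_lt_mul_right_of_ne hb (lt_of_le_of_ne (zero_le a) ha.symm)
  rw [zero_mul] at h
  exact h.ne'

theorem one_ne_zero' : (1 : TMax Γ) ≠ 0 := WithBot.coe_ne_bot (a := (0 : Γ))

instance : NoZeroDivisors (TMax Γ) where
  eq_zero_or_eq_zero_of_mul_eq_zero h := by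
    by_contra! hc
    exact mul_ne_zero' hc.1 hc.2 h

instance : Nontrivial (TMax Γ) := ⟨1, 0, one_ne_zero'⟩

theorem le_of_mul_le_mul_right {a b c : TMax Γ} (hc : c ≠ 0) (h : a * c ≤ b * c) : a ≤ b := by
  by_contra! hlt
  exact absurd h (mul_lt_mul_right_of_ne hc hlt).not_ge

theorem mul_right_cancel_of_ne {a b c : TMax Γ} (hc : c ≠ 0) (h : a * c = b * c) : a = b :=
  (le_of_mul_le_mul_right hc h.le).antisymm (le_of_mul_le_mul_right hc h.ge)

theorem mul_le_mul'' {a b c d : TMax Γ} (h : a ≤ b) (h' : c ≤ d) : a * c ≤ b * d := by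
  refine (mul_le_mul_right_of_le c h).trans ?_
  rw [mul_comm b, mul_comm b]
  exact mul_le_mul_right_of_le b h'

theorem pow_lt_pow_of_lt {a b : TMax Γ} (ha : a ≠ 0) (h : a < b) {d : ℕ} (hd : 0 < d) :
    a ^ d < b ^ d := by
  have hb : b ≠ 0 := ((zero_le a).trans_lt h).ne'
  induction d, hd using Nat.le_induction with
  | base => simpa using h
  | succ d _ ih =>
    rw [pow_succ, pow_succ]
    exact (mul_lt_mul_right_of_ne ha ih).trans_le (mul_le_mul'' le_rfl h.le)

theorem le_sum {ι : Type*} {s : Finset ι} (f : ι → TMax Γ) {i : ι} (hi : i ∈ s) :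
    f i ≤ ∑ j ∈ s, f j := by
  classical
  rw [← Finset.add_sum_erase s f hi, add_eq_max]
  exact le_max_left _ _

theorem exists_eq_sum {ι : Type*} {s : Finset ι} {f : ι → TMax Γ} (h : ∑ j ∈ s, f j ≠ 0) :
    ∃ i ∈ s, f i = ∑ j ∈ s, f j := by
  classical
  induction s using Finset.induction_on with
  | empty => simp at h
  | insert a s ha ih =>
    rw [Finset.sum_insert ha, add_eq_max] at h ⊢
    rcases le_total (f a) (∑ j ∈ s, f j) with hle | hle
    · rw [max_eq_right hle] at h ⊢
      obtain ⟨i, hi, e⟩ := ih h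
      exact ⟨i, Finset.mem_insert_of_mem hi, e⟩
    · rw [max_eq_left hle]
      exact ⟨a, Finset.mem_insert_self _ _, rfl⟩

theorem coeff_mul_pow_le_eval (p : (TMax Γ)[X]) (c : TMax Γ) (k : ℕ) :
    p.coeff k * c ^ k ≤ p.eval c := by
  by_cases hk : k ∈ p.support
  · rw [eval_eq_sum, Polynomial.sum]
    exact le_sum (fun k => p.coeff k * c ^ k) hk
  · rw [notMem_support_iff.1 hk, zero_mul]
    exact zero_le _

theorem eval_ne_zero {p : (TMax Γ)[X]} {c : TMax Γ} (hp : p ≠ 0) (hc : c ≠ 0) :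
    p.eval c ≠ 0 := by
  intro h
  apply hp
  ext k
  have := coeff_mul_pow_le_eval p c k
  rw [h] at this
  have := this.antisymm (zero_le _)
  simpa [hc] using this

theorem mem_maxExponents {p : (TMax Γ)[X]} {c : TMax Γ} (hp : p ≠ 0) (hc : c ≠ 0) {k : ℕ} :
    k ∈ maxExponents p c ↔ p.coeff k * c ^ k = p.eval c := by
  simp only [maxExponents, Finset.mem_filter, mem_support_iff, and_iff_right_iff_imp]
  intro h h0
  rw [h0, zero_mul] at h
  exact eval_ne_zero hp hc h.symm

theorem maxExponents_nonempty {p : (TMax Γ)[X]} {c : TMax Γ} (hp : p ≠ 0) (hc : c ≠ 0) :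
    (maxExponents p c).Nonempty := by
  have h := eval_ne_zero hp hc
  rw [eval_eq_sum, Polynomial.sum] at h
  obtain ⟨i, -, hi⟩ := exists_eq_sum h
  refine ⟨i, (mem_maxExponents hp hc).2 ?_⟩
  rw [hi, eval_eq_sum, Polynomial.sum]

/-- If `i = j + d` with `d > 0`, maximality at `c` and at `c'` gives `p_i c'^d ≤ p_j ≤ p_i c^d`,
against `c < c'`. -/
theorem le_of_mem_maxExponents {p : (TMax Γ)[X]} {c c' : TMax Γ} (hp : p ≠ 0) (hc : c ≠ 0)
    (h : c < c') {i j : ℕ} (hi : i ∈ maxExponents p c) (hj : j ∈ maxExponents p c') : i ≤ j := by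
  have hc' : c' ≠ 0 := ((zero_le c).trans_lt h).ne'
  by_contra! hlt
  obtain ⟨d, rfl⟩ := Nat.exists_eq_add_of_le hlt.le
  have hd : 0 < d := by omega
  have hpi : p.coeff (j + d) ≠ 0 := mem_support_iff.1 (Finset.mem_filter.1 hi).1
  rw [mem_maxExponents hp hc] at hi
  rw [mem_maxExponents hp hc'] at hj
  have h1 := coeff_mul_pow_le_eval p c j
  have h2 := coeff_mul_pow_le_eval p c' (j + d)
  rw [← hi, pow_add, mul_comm (c ^ j), ← mul_assoc] at h1
  rw [← hj, pow_add, mul_comm (c' ^ j), ← mul_assoc] at h2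
  have h3 := (le_of_mul_le_mul_right (pow_ne_zero _ hc') h2).trans
    (le_of_mul_le_mul_right (pow_ne_zero _ hc) h1)
  rw [mul_comm, mul_comm _ (c ^ d)] at h3
  exact absurd (le_of_mul_le_mul_right hpi h3) (pow_lt_pow_of_lt hc h hd).not_ge

/-! ### Disjoint exponent intervals of the corners -/

open Classical in
/-- The exponents between the smallest (included) and the largest (excluded) that attain the
maximum at `c`. -/
noncomputable def cornerInterval (p : (TMax Γ)[X]) (c : TMax Γ) : Finset ℕ :=
  if c = 0 then Finset.range p.natTrailingDegree
  else Finset.Ico (sInf (maxExponents p c : Set ℕ)) (sSup (maxExponents p c : Set ℕ))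

theorem card_cornerInterval (p : (TMax Γ)[X]) (c : TMax Γ) :
    (cornerInterval p c).card = cornerMult p c := by
  simp only [cornerInterval, cornerMult]
  split_ifs <;> simp

theorem le_sSup_maxExponents {p : (TMax Γ)[X]} {c : TMax Γ} {k : ℕ} (hk : k ∈ maxExponents p c) :
    k ≤ sSup (maxExponents p c : Set ℕ) :=
  le_csSup (Finset.bddAbove _) hk

theorem sInf_maxExponents_le {p : (TMax Γ)[X]} {c : TMax Γ} {k : ℕ} (hk : k ∈ maxExponents p c) :
    sInf (maxExponents p c : Set ℕ) ≤ k :=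
  Nat.sInf_le hk

theorem sSup_mem_maxExponents {p : (TMax Γ)[X]} {c : TMax Γ} (hp : p ≠ 0) (hc : c ≠ 0) :
    sSup (maxExponents p c : Set ℕ) ∈ maxExponents p c :=
  Nat.sSup_mem (maxExponents_nonempty hp hc) (Finset.bddAbove _)

theorem sInf_mem_maxExponents {p : (TMax Γ)[X]} {c : TMax Γ} (hp : p ≠ 0) (hc : c ≠ 0) :
    sInf (maxExponents p c : Set ℕ) ∈ maxExponents p c :=
  Nat.sInf_mem (s := (maxExponents p c : Set ℕ)) (maxExponents_nonempty hp hc)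

theorem cornerInterval_subset {p : (TMax Γ)[X]} (hp : p ≠ 0) (c : TMax Γ) :
    cornerInterval p c ⊆ Finset.range p.natDegree := by
  intro x hx
  simp only [cornerInterval] at hx
  rw [Finset.mem_range]
  split_ifs at hx with hc
  · exact (Finset.mem_range.1 hx).trans_le (natTrailingDegree_le_natDegree p)
  · exact (Finset.mem_Ico.1 hx).2.trans_le
      (le_natDegree_of_mem_supp _ (Finset.mem_filter.1 (sSup_mem_maxExponents hp hc)).1)

/-- Maximal exponents move right as `c` grows, so two intervals share at most an endpoint, and the
right one is excluded. The interval of zero lies below the whole support. -/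
theorem lt_of_mem_cornerInterval {p : (TMax Γ)[X]} (hp : p ≠ 0) {c c' : TMax Γ} (h : c < c')
    {x y : ℕ} (hx : x ∈ cornerInterval p c) (hy : y ∈ cornerInterval p c') : x < y := by
  have hc' : c' ≠ 0 := ((zero_le c).trans_lt h).ne'
  simp only [cornerInterval, if_neg hc', Finset.mem_Ico] at hx hy
  refine lt_of_lt_of_le ?_ hy.1
  have hm := sInf_mem_maxExponents hp hc'
  split_ifs at hx with hc
  · exact (Finset.mem_range.1 hx).trans_le
      (natTrailingDegree_le_of_mem_supp _ (Finset.mem_filter.1 hm).1)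
  · exact (Finset.mem_Ico.1 hx).2.trans_le
      (le_of_mem_maxExponents hp hc h (sSup_mem_maxExponents hp hc) hm)

theorem disjoint_cornerInterval {p : (TMax Γ)[X]} (hp : p ≠ 0) {c c' : TMax Γ} (h : c ≠ c') :
    Disjoint (cornerInterval p c) (cornerInterval p c') := by
  rw [Finset.disjoint_left]
  intro x hx hx'
  rcases h.lt_or_gt with h | h
  · exact lt_irrefl _ (lt_of_mem_cornerInterval hp h hx hx')
  · exact lt_irrefl _ (lt_of_mem_cornerInterval hp h hx' hx)

theorem sum_cornerMult_le {p : (TMax Γ)[X]} (hp : p ≠ 0) (s : Finset (TMax Γ)) :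
    ∑ c ∈ s, cornerMult p c ≤ p.natDegree := by
  simp_rw [← card_cornerInterval]
  rw [← Finset.card_biUnion fun c _ c' _ h => disjoint_cornerInterval hp h]
  calc _ ≤ (Finset.range p.natDegree).card :=
        Finset.card_le_card (Finset.biUnion_subset.2 fun c _ => cornerInterval_subset hp c)
    _ = _ := Finset.card_range _

theorem IsCorner.cornerInterval_nonempty {p : (TMax Γ)[X]} (hp : p ≠ 0) {c : TMax Γ}
    (h : IsCorner p c) : (cornerInterval p c).Nonempty := by
  simp only [IsCorner, cornerInterval] at h ⊢
  split_ifs at h ⊢ with hc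
  · rw [Finset.nonempty_range_iff, Ne, natTrailingDegree_eq_zero]
    tauto
  · rw [Finset.nonempty_Ico]
    obtain ⟨i, hi, j, hj, hij⟩ := Finset.one_lt_card.1 h
    have := le_sSup_maxExponents hi
    have := le_sSup_maxExponents hj
    have := sInf_maxExponents_le hi
    have := sInf_maxExponents_le hj
    omega

/-- Choosing a point in each interval injects the corners into `range p.natDegree`. -/
theorem finite_setOf_isCorner {p : (TMax Γ)[X]} (hp : p ≠ 0) : {c | IsCorner p c}.Finite := by
  have h : ∀ c : TMax Γ, ∃ x, IsCorner p c → x ∈ cornerInterval p c := fun c => by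
    by_cases hc : IsCorner p c
    · obtain ⟨x, hx⟩ := hc.cornerInterval_nonempty hp
      exact ⟨x, fun _ => hx⟩
    · exact ⟨0, fun h => absurd h hc⟩
  choose g hg using h
  refine Set.Finite.of_injOn (f := g) (t := Finset.range p.natDegree)
    (fun c hc => cornerInterval_subset hp c (hg c hc)) (fun c hc c' hc' e => ?_)
    (Finset.finite_toSet _)
  by_contra hne
  exact Finset.disjoint_left.1 (disjoint_cornerInterval hp hne) (hg c hc) (e ▸ hg c' hc')

end TMax

/-! ### Signed elements -/

namespace SMax

variable {Γ : Type*} [AddCommGroup Γ] [LinearOrder Γ] [IsOrderedAddMonoid Γ]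

theorem mk_eq_mk {x y : TPair Γ} : mk x = mk y ↔ TPair.Rel x y := (TPair.con Γ).eq

theorem mk_surjective (a : SMax Γ) : ∃ x, mk x = a := Quotient.exists_rep a

theorem abs_mk (x : TPair Γ) : abs (mk x) = max x.fst x.snd := rfl

theorem neg_mk (x : TPair Γ) : neg (mk x) = mk ⟨x.snd, x.fst⟩ := rfl

theorem balances_mk {x y : TPair Γ} :
    Balances (mk x) (mk y) ↔ max x.fst y.snd = max x.snd y.fst := Iff.rfl

theorem mk_pos_eq_mk_pos {c d : TMax Γ} : mk ⟨c, 0⟩ = mk ⟨d, 0⟩ ↔ c = d := by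
  rw [mk_eq_mk, TPair.rel_iff]
  have := TMax.zero_le c
  have := TMax.zero_le d
  simp only [TPair.mk.injEq]
  grind

theorem mk_pos_eq_mk_neg {c d : TMax Γ} : mk ⟨c, 0⟩ = mk ⟨0, d⟩ ↔ c = 0 ∧ d = 0 := by
  rw [mk_eq_mk, TPair.rel_iff]
  have := TMax.zero_le c
  have := TMax.zero_le d
  simp only [TPair.mk.injEq]
  grind

theorem mk_neg_eq_mk_neg {c d : TMax Γ} : mk ⟨0, c⟩ = mk ⟨0, d⟩ ↔ c = d := by
  rw [mk_eq_mk, TPair.rel_iff]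
  have := TMax.zero_le c
  have := TMax.zero_le d
  simp only [TPair.mk.injEq]
  grind

theorem abs_eq_zero {a : SMax Γ} : abs a = 0 ↔ a = 0 := by
  constructor
  · obtain ⟨⟨x, y⟩, rfl⟩ := mk_surjective a
    intro h
    rw [abs_mk] at h
    have hx : x = 0 := ((le_max_left x y).trans h.le).antisymm (TMax.zero_le x)
    have hy : y = 0 := ((le_max_right x y).trans h.le).antisymm (TMax.zero_le y)
    subst hx hy
    exact map_zero mk
  · rintro rfl
    exact map_zero abs

theorem isSigned_zero : IsSigned (0 : SMax Γ) := ⟨0, Or.inl (map_zero mk).symm⟩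

theorem isSigned_one : IsSigned (1 : SMax Γ) := ⟨1, Or.inl (map_one mk).symm⟩

theorem mk_mul_mk (a b c d : TMax Γ) :
    (mk ⟨a, b⟩ * mk ⟨c, d⟩ : SMax Γ) = mk ⟨a * c + b * d, a * d + b * c⟩ := (map_mul mk _ _).symm

theorem mk_add_mk (a b c d : TMax Γ) :
    (mk ⟨a, b⟩ + mk ⟨c, d⟩ : SMax Γ) = mk ⟨max a c, max b d⟩ := (map_add mk _ _).symm

theorem IsSigned.mul {a b : SMax Γ} (ha : IsSigned a) (hb : IsSigned b) : IsSigned (a * b) := by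
  obtain ⟨c, rfl | rfl⟩ := ha <;> obtain ⟨d, rfl | rfl⟩ := hb <;>
    refine ⟨c * d, ?_⟩ <;> simp [mk_mul_mk]

theorem IsSigned.pow {a : SMax Γ} (ha : IsSigned a) (n : ℕ) : IsSigned (a ^ n) := by
  induction n with
  | zero => simpa using isSigned_one
  | succ n ih => rw [pow_succ]; exact ih.mul ha

theorem IsSigned.neg {a : SMax Γ} (ha : IsSigned a) : IsSigned (neg a) := by
  obtain ⟨c, rfl | rfl⟩ := ha
  · exact ⟨c, Or.inr rfl⟩
  · exact ⟨c, Or.inl rfl⟩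

theorem abs_neg (a : SMax Γ) : abs (neg a) = abs a := by
  obtain ⟨x, rfl⟩ := mk_surjective a
  exact max_comm _ _

theorem neg_mul (a b : SMax Γ) : neg a * b = neg (a * b) := by
  obtain ⟨⟨x, y⟩, rfl⟩ := mk_surjective a
  obtain ⟨⟨z, w⟩, rfl⟩ := mk_surjective b
  simp only [neg_mk, mk_mul_mk]
  rw [add_comm (y * z), add_comm (y * w)]

theorem neg_zero : neg (0 : SMax Γ) = 0 := abs_eq_zero.1 (by rw [abs_neg, map_zero])

theorem mul_eq_zero_iff {a b : SMax Γ} : a * b = 0 ↔ a = 0 ∨ b = 0 := by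
  rw [← abs_eq_zero, map_mul, mul_eq_zero, abs_eq_zero, abs_eq_zero]

theorem Balances.mul_right {a b : SMax Γ} (h : Balances a b) (c : SMax Γ) :
    Balances (a * c) (b * c) := by
  obtain ⟨⟨x, y⟩, rfl⟩ := mk_surjective a
  obtain ⟨⟨z, w⟩, rfl⟩ := mk_surjective b
  obtain ⟨⟨u, v⟩, rfl⟩ := mk_surjective c
  rw [mk_mul_mk, mk_mul_mk]
  have h : x + w = y + z := h
  change x * u + y * v + (z * v + w * u) = x * v + y * u + (z * u + w * v)
  calc _ = (x + w) * u + (y + z) * v := by ring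
    _ = (y + z) * u + (x + w) * v := by rw [h]
    _ = _ := by ring

/-- A signed class has a representative with a zero coordinate, which leaves no room for a balance
other than equality. This is how balances force coefficients to vanish. -/
theorem Balances.eq {a b : SMax Γ} (ha : IsSigned a) (hb : IsSigned b) (h : Balances a b) :
    a = b := by
  obtain ⟨c, rfl | rfl⟩ := ha <;> obtain ⟨d, rfl | rfl⟩ := hb <;> rw [balances_mk] at h <;>
    have := TMax.zero_le c <;> have := TMax.zero_le d <;>
    simp only [mk_pos_eq_mk_pos, mk_pos_eq_mk_neg, eq_comm (a := mk ⟨0, _⟩) (b := mk ⟨_, 0⟩),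
      mk_neg_eq_mk_neg] <;> grind

/-! ### Signs at a given absolute value -/

open Classical in
/-- The sign of a signed element `a` if its absolute value is `m`, and zero otherwise. -/
noncomputable def signAt (m : TMax Γ) (a : SMax Γ) : SignType :=
  if a = mk ⟨m, 0⟩ then 1 else if a = mk ⟨0, m⟩ then -1 else 0

-- The condition `m ≠ 0` matters: for `m = 0` the positive and the negative class coincide.
open Classical in
theorem signAt_mk_pos {m : TMax Γ} (hm : m ≠ 0) (c : TMax Γ) :
    signAt m (mk ⟨c, 0⟩) = if c = m then 1 else 0 := by
  simp [signAt, mk_pos_eq_mk_pos, mk_pos_eq_mk_neg, hm]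

open Classical in
theorem signAt_mk_neg {m : TMax Γ} (hm : m ≠ 0) (c : TMax Γ) :
    signAt m (mk ⟨0, c⟩) = if c = m then -1 else 0 := by
  simp [signAt, eq_comm (a := mk ⟨0, _⟩) (b := mk ⟨_, 0⟩), mk_neg_eq_mk_neg, mk_pos_eq_mk_neg, hm]

theorem signAt_ne_zero {m : TMax Γ} (hm : m ≠ 0) {a : SMax Γ} (ha : IsSigned a) :
    signAt m a ≠ 0 ↔ abs a = m := by
  obtain ⟨c, rfl | rfl⟩ := ha
  · simp [signAt_mk_pos hm, abs_mk, max_eq_left (TMax.zero_le c)]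
  · simp [signAt_mk_neg hm, abs_mk, max_eq_right (TMax.zero_le c)]

theorem signAt_neg {m : TMax Γ} (hm : m ≠ 0) {a : SMax Γ} (ha : IsSigned a) :
    signAt m (neg a) = -signAt m a := by
  obtain ⟨c, rfl | rfl⟩ := ha <;> simp only [neg_mk, signAt_mk_neg hm, signAt_mk_pos hm] <;>
    split_ifs <;> simp

theorem signAt_mul {s x : SMax Γ} {m : TMax Γ} (hs : IsSigned s) (hx : IsSigned x) (hs0 : s ≠ 0)
    (hm : m ≠ 0) : signAt (abs s * m) (s * x) = signAt (abs s) s * signAt m x := by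
  have hs' : abs s ≠ 0 := mt abs_eq_zero.1 hs0
  have hsm := mul_ne_zero hs' hm
  have key : ∀ c d : TMax Γ, c ≠ 0 → (c * d = c * m ↔ d = m) := fun c d hc => by
    refine ⟨fun h => TMax.mul_right_cancel_of_ne hc ?_, fun h => by rw [h]⟩
    rw [mul_comm, h, mul_comm]
  obtain ⟨c, rfl | rfl⟩ := hs <;> obtain ⟨d, rfl | rfl⟩ := hx <;>
    have hc := TMax.zero_le c <;>
    simp only [abs_mk, max_eq_left hc, max_eq_right hc] at hs' hsm ⊢ <;>
    simp [mk_mul_mk, signAt_mk_pos, signAt_mk_neg, hm, hsm, hs', key]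

/-- Only terms of absolute value `m` count. If `x` is smaller, `a` must match `⊖ y` at level `m`. If
`x` has level `m` and `y` does not cancel it, `x ⊖ y` agrees with `x` there and determines `a`. If
`x` and `y` have the same sign at level `m`, the difference is balanced and leaves `a` free. -/
theorem signDiff_of_balances {m : TMax Γ} (hm : m ≠ 0) {x y a : SMax Γ} (hx : IsSigned x)
    (hy : IsSigned y) (ha : IsSigned a) (hxm : abs x ≤ m) (hym : abs y ≤ m) (ham : abs a ≤ m)
    (h : Balances a (x + neg y)) : SignDiff (signAt m x) (signAt m y) (signAt m a) := by
  obtain ⟨x, rfl | rfl⟩ := hx <;> obtain ⟨y, rfl | rfl⟩ := hy <;> obtain ⟨a, rfl | rfl⟩ := ha <;>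
    have hx0 := TMax.zero_le x <;> have hy0 := TMax.zero_le y <;> have ha0 := TMax.zero_le a <;>
    simp only [neg_mk, mk_add_mk, balances_mk, abs_mk, signAt_mk_pos hm, signAt_mk_neg hm,
      max_eq_left hx0, max_eq_right hx0, max_eq_left hy0, max_eq_right hy0, max_eq_left ha0,
      max_eq_right ha0, SignDiff, max_self] at h hxm hym ham ⊢ <;>
    have hm0 := lt_of_le_of_ne (TMax.zero_le m) hm.symm <;>
    constructor <;> split_ifs <;> simp <;> grind

/-- In a balance of signed terms, no single term can strictly dominate the others. -/
theorem abs_le_of_balances {x y a : SMax Γ} (hx : IsSigned x)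
    (hy : IsSigned y) (ha : IsSigned a) (h : Balances a (x + neg y)) :
    abs a ≤ max (abs x) (abs y) ∧ abs y ≤ max (abs a) (abs x) := by
  obtain ⟨x, rfl | rfl⟩ := hx <;> obtain ⟨y, rfl | rfl⟩ := hy <;> obtain ⟨a, rfl | rfl⟩ := ha <;>
    have hx0 := TMax.zero_le x <;> have hy0 := TMax.zero_le y <;> have ha0 := TMax.zero_le a <;>
    simp only [neg_mk, mk_add_mk, balances_mk, abs_mk,
      max_eq_left hx0, max_eq_right hx0, max_eq_left hy0, max_eq_right hy0, max_eq_left ha0,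
      max_eq_right ha0, max_self] at h ⊢ <;>
    grind

/-- A balanced sum of signed elements contains terms of both signs of maximal absolute value. -/
theorem exists_signAt_of_balances_sum {ι : Type*} {s : Finset ι} {f : ι → SMax Γ}
    (hf : ∀ i, IsSigned (f i)) (h : Balances (∑ i ∈ s, f i) 0) (h0 : ∑ i ∈ s, abs (f i) ≠ 0) :
    (∃ i ∈ s, signAt (∑ i ∈ s, abs (f i)) (f i) = 1) ∧
      ∃ i ∈ s, signAt (∑ i ∈ s, abs (f i)) (f i) = -1 := by
  have hrep : ∀ i, ∃ x y : TMax Γ, f i = mk ⟨x, y⟩ ∧ (x = 0 ∨ y = 0) := fun i => by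
    obtain ⟨c, h | h⟩ := hf i
    · exact ⟨c, 0, h, Or.inr rfl⟩
    · exact ⟨0, c, h, Or.inl rfl⟩
  choose x y hxy h0xy using hrep
  have hfst : ∀ g : ι → TPair Γ, (∑ i ∈ s, g i).fst = ∑ i ∈ s, (g i).fst := fun g =>
    map_sum (⟨⟨TPair.fst, rfl⟩, fun _ _ => rfl⟩ : TPair Γ →+ TMax Γ) g s
  have hsnd : ∀ g : ι → TPair Γ, (∑ i ∈ s, g i).snd = ∑ i ∈ s, (g i).snd := fun g =>
    map_sum (⟨⟨TPair.snd, rfl⟩, fun _ _ => rfl⟩ : TPair Γ →+ TMax Γ) g s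
  have hsum : ∑ i ∈ s, f i = mk (∑ i ∈ s, ⟨x i, y i⟩) := by
    rw [map_sum]
    exact Finset.sum_congr rfl fun i _ => hxy i
  -- The positive and the negative parts have the same maximum; a term attaining it on either side
  -- has the required sign.
  have hbal : ∑ i ∈ s, x i = ∑ i ∈ s, y i := by
    rw [hsum, ← map_zero mk, balances_mk] at h
    simpa [hfst, hsnd, max_eq_left (TMax.zero_le _)] using h
  have habs : ∑ i ∈ s, abs (f i) = ∑ i ∈ s, x i := by
    rw [← map_sum, hsum, abs_mk, hfst, hsnd]
    simp [hbal]
  rw [habs] at h0 ⊢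
  refine ⟨?_, ?_⟩
  · obtain ⟨i, hi, e⟩ := TMax.exists_eq_sum h0
    refine ⟨i, hi, ?_⟩
    have hy : y i = 0 := (h0xy i).resolve_left (e ▸ h0)
    rw [hxy, hy, signAt_mk_pos h0, if_pos e]
  · obtain ⟨i, hi, e⟩ := TMax.exists_eq_sum (hbal ▸ h0)
    refine ⟨i, hi, ?_⟩
    have hx : x i = 0 := (h0xy i).resolve_right (e ▸ hbal ▸ h0)
    rw [hxy, hx, signAt_mk_neg h0, hbal, if_pos e]

end SMax

/-! ### Multiplicities of roots -/

namespace SMax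

variable {Γ : Type*} [AddCommGroup Γ] [LinearOrder Γ] [IsOrderedAddMonoid Γ]

theorem map_abs_ne_zero {P : (SMax Γ)[X]} (hP : P ≠ 0) : P.map abs ≠ 0 := by
  intro h
  apply hP
  ext k
  rw [coeff_zero, ← abs_eq_zero, ← coeff_map, h, coeff_zero]

theorem abs_eval (P : (SMax Γ)[X]) (r : SMax Γ) :
    abs (P.eval r) = (P.map abs).eval (abs r) := by
  rw [eval_map, eval₂_at_apply]

theorem abs_coeff_mul_pow (P : (SMax Γ)[X]) (r : SMax Γ) (k : ℕ) :
    abs (P.coeff k * r ^ k) = (P.map abs).coeff k * abs r ^ k := by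
  rw [map_mul, map_pow, coeff_map]

/-- The signs of the terms of maximal absolute value of `P` at `r`. -/
noncomputable def signSeq (r : SMax Γ) (P : (SMax Γ)[X]) (k : ℕ) : SignType :=
  signAt ((P.map abs).eval (abs r)) (P.coeff k * r ^ k)

/-- The number of sign changes among the terms of maximal absolute value of `P` at `r`. -/
noncomputable def variation (r : SMax Γ) (P : (SMax Γ)[X]) : ℕ :=
  (signScan (signSeq r P) (P.natDegree + 1)).2

section

variable {r : SMax Γ} {P : (SMax Γ)[X]}

theorem eval_abs_ne_zero (hr0 : r ≠ 0) (hP0 : P ≠ 0) : (P.map abs).eval (abs r) ≠ 0 :=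
  TMax.eval_ne_zero (map_abs_ne_zero hP0) (mt abs_eq_zero.1 hr0)

theorem signSeq_ne_zero (hr : IsSigned r) (hr0 : r ≠ 0) (hP : IsSignedPoly P) (hP0 : P ≠ 0)
    {k : ℕ} : signSeq r P k ≠ 0 ↔ k ∈ TMax.maxExponents (P.map abs) (abs r) := by
  rw [signSeq, signAt_ne_zero (eval_abs_ne_zero hr0 hP0) ((hP k).mul (hr.pow k)),
    abs_coeff_mul_pow, TMax.mem_maxExponents (map_abs_ne_zero hP0) (mt abs_eq_zero.1 hr0)]

theorem le_natDegree_of_mem_maxExponents {k : ℕ}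
    (hk : k ∈ TMax.maxExponents (P.map abs) (abs r)) : k ≤ P.natDegree :=
  (le_natDegree_of_mem_supp _ (Finset.mem_filter.1 hk).1).trans natDegree_map_le

/-- Any cutoff beyond the maximal exponents gives the same count, so polynomials of different
degrees can be scanned over a common length. -/
theorem variation_eq (hr : IsSigned r) (hr0 : r ≠ 0) (hP : IsSignedPoly P) (hP0 : P ≠ 0)
    {n : ℕ} (hn : ∀ k, n ≤ k → k ∉ TMax.maxExponents (P.map abs) (abs r)) :
    (signScan (signSeq r P) n).2 = variation r P := by
  have hn' : ∀ k, n ≤ k → signSeq r P k = 0 := fun k hk => by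
    by_contra h
    exact hn k hk ((signSeq_ne_zero hr hr0 hP hP0).1 h)
  have hd : ∀ k, P.natDegree + 1 ≤ k → signSeq r P k = 0 := fun k hk => by
    by_contra h
    have := le_natDegree_of_mem_maxExponents ((signSeq_ne_zero hr hr0 hP hP0).1 h)
    omega
  rw [variation, ← signScan_eq_of_zero (le_max_left n (P.natDegree + 1)) hn',
    ← signScan_eq_of_zero (le_max_right n (P.natDegree + 1)) hd]

theorem exists_signSeq_of_root (hP : IsSignedPoly P) (hP0 : P ≠ 0) (hr0 : r ≠ 0)
    (h : IsSignedRoot P r) : (∃ k, signSeq r P k = 1) ∧ ∃ k, signSeq r P k = -1 := by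
  have hev : P.eval r = ∑ k ∈ P.support, P.coeff k * r ^ k := by
    rw [eval_eq_sum, Polynomial.sum]
  have habs : (P.map abs).eval (abs r) = ∑ k ∈ P.support, abs (P.coeff k * r ^ k) := by
    rw [← abs_eval, hev, map_sum]
  have h0 := eval_abs_ne_zero hr0 hP0
  have hb := h.2
  rw [hev] at hb
  rw [habs] at h0
  obtain ⟨⟨i, -, hi⟩, j, -, hj⟩ := exists_signAt_of_balances_sum
    (fun k => (hP k).mul (h.1.pow k)) hb h0
  exact ⟨⟨i, by rw [signSeq, habs, hi]⟩, j, by rw [signSeq, habs, hj]⟩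

/-- For `r ≠ 0`, maximal terms of opposite signs have distinct exponents. For `r = 0`, the constant
coefficient is signed and balances zero, hence vanishes. -/
theorem isCorner_of_root (hP : IsSignedPoly P) (hP0 : P ≠ 0) (h : IsSignedRoot P r) :
    TMax.IsCorner (P.map abs) (abs r) := by
  rw [TMax.IsCorner]
  split_ifs with hr
  · rw [abs_eq_zero] at hr
    have hb := h.2
    rw [hr, ← coeff_zero_eq_eval_zero] at hb
    rw [coeff_map, hb.eq (hP 0) isSigned_zero, map_zero]
  · have hr0 : r ≠ 0 := mt abs_eq_zero.2 hr
    obtain ⟨⟨i, hi⟩, j, hj⟩ := exists_signSeq_of_root hP hP0 hr0 h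
    refine Finset.one_lt_card.2
      ⟨i, (signSeq_ne_zero h.1 hr0 hP hP0).1 ?_, j, (signSeq_ne_zero h.1 hr0 hP hP0).1 ?_, ?_⟩
    · rw [hi]; decide
    · rw [hj]; decide
    · rintro rfl
      rw [hi] at hj
      revert hj
      decide

theorem one_le_variation (hP : IsSignedPoly P) (hP0 : P ≠ 0) (hr0 : r ≠ 0)
    (h : IsSignedRoot P r) : 1 ≤ variation r P := by
  by_contra! hlt
  have hle : ∀ k, signSeq r P k ≠ 0 → k < P.natDegree + 1 := fun k hk =>
    Nat.lt_succ_of_le (le_natDegree_of_mem_maxExponents ((signSeq_ne_zero h.1 hr0 hP hP0).1 hk))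
  have hv := eq_of_signScan_eq_zero (P.natDegree + 1) (Nat.lt_one_iff.1 hlt)
  obtain ⟨⟨i, hi⟩, j, hj⟩ := exists_signSeq_of_root hP hP0 hr0 h
  have hi' := hv i (hle i (by rw [hi]; decide))
  have hj' := hv j (hle j (by rw [hj]; decide))
  rw [hi] at hi'
  rw [hj, ← hi'.resolve_left (by decide)] at hj'
  revert hj'
  decide

theorem IsQuotient.ne_zero {Q : (SMax Γ)[X]} (hP : IsSignedPoly P) (hP0 : P ≠ 0)
    (h : IsQuotient r P Q) : Q ≠ 0 := by
  rintro rfl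
  obtain ⟨-, lam, hlam, hlam0, hb⟩ := h
  apply hP0
  ext k
  have := hb k
  rw [mul_zero, coeff_zero, coeff_C_mul] at this
  exact (mul_eq_zero_iff.1 (this.eq (hlam.mul (hP k)) isSigned_zero)).resolve_left hlam0

/-- After multiplication by `r^k`, the balance of the coefficients of index `k` compares `lam P_k
r^k` with the difference of two consecutive terms `r Q_j r^j`. Both sequences have the same maximal
absolute value `M`, so `signScan_diff` applies to their signs at level `M`. -/
theorem IsQuotient.variation_lt {Q : (SMax Γ)[X]} (hr : IsSigned r) (hr0 : r ≠ 0)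
    (hP : IsSignedPoly P) (hP0 : P ≠ 0) (h : IsQuotient r P Q) :
    variation r Q + 1 ≤ variation r P := by
  have hQ0 := h.ne_zero hP hP0
  obtain ⟨hQ, lam, hlam, hlam0, hb⟩ := h
  have hA0 := eval_abs_ne_zero hr0 hP0
  have hB0 := eval_abs_ne_zero hr0 hQ0
  have hsP : ∀ k, IsSigned (P.coeff k * r ^ k) := fun k => (hP k).mul (hr.pow k)
  have hsQ : ∀ k, IsSigned (Q.coeff k * r ^ k) := fun k => (hQ k).mul (hr.pow k)
  have hsa : ∀ k, IsSigned (lam * (P.coeff k * r ^ k)) := fun k => hlam.mul (hsP k)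
  have hsq : ∀ k, IsSigned (r * (Q.coeff k * r ^ k)) := fun k => hr.mul (hsQ k)
  have hb0 : Balances (lam * (P.coeff 0 * r ^ 0)) (0 + neg (r * (Q.coeff 0 * r ^ 0))) := by
    have := hb 0
    rw [coeff_C_mul, add_mul, coeff_add, coeff_X_mul_zero, coeff_C_mul, neg_mul] at this
    simpa using this
  have hb1 : ∀ k, Balances (lam * (P.coeff (k + 1) * r ^ (k + 1)))
      (r * (Q.coeff k * r ^ k) + neg (r * (Q.coeff (k + 1) * r ^ (k + 1)))) := fun k => by
    have := (hb (k + 1)).mul_right (r ^ (k + 1))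
    rw [coeff_C_mul, add_mul, coeff_add, coeff_X_mul, coeff_C_mul, neg_mul, add_mul, neg_mul,
      mul_assoc, mul_assoc r] at this
    convert this using 2
    ring
  have hale : ∀ k, abs (lam * (P.coeff k * r ^ k)) ≤ abs lam * (P.map abs).eval (abs r) :=
    fun k => by
      rw [map_mul, abs_coeff_mul_pow]
      exact TMax.mul_le_mul'' le_rfl (TMax.coeff_mul_pow_le_eval _ _ _)
  have hqle : ∀ k, abs (r * (Q.coeff k * r ^ k)) ≤ abs r * (Q.map abs).eval (abs r) :=
    fun k => by
      rw [map_mul, abs_coeff_mul_pow]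
      exact TMax.mul_le_mul'' le_rfl (TMax.coeff_mul_pow_le_eval _ _ _)
  have hMeq : abs lam * (P.map abs).eval (abs r) = abs r * (Q.map abs).eval (abs r) := by
    have hr0' := mt abs_eq_zero.1 hr0
    apply le_antisymm
    · obtain ⟨k, hk⟩ := TMax.maxExponents_nonempty (map_abs_ne_zero hP0) hr0'
      rw [TMax.mem_maxExponents (map_abs_ne_zero hP0) hr0', ← abs_coeff_mul_pow] at hk
      rw [← hk, ← map_mul]
      cases k with
      | zero =>
        refine (abs_le_of_balances isSigned_zero (hsq 0) (hsa 0) hb0).1.trans (max_le ?_ (hqle 0))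
        rw [map_zero]
        exact TMax.zero_le _
      | succ k =>
        exact (abs_le_of_balances (hsq k) (hsq _) (hsa _) (hb1 k)).1.trans
          (max_le (hqle k) (hqle _))
    -- Each quotient term is bounded by the term of `P` of the same index and the previous quotient
    -- term, so the bound propagates upwards from index zero.
    · have hq : ∀ k, abs (r * (Q.coeff k * r ^ k)) ≤ abs lam * (P.map abs).eval (abs r) := by
        intro k
        induction k with
        | zero =>
          refine (abs_le_of_balances isSigned_zero (hsq 0) (hsa 0) hb0).2.trans
            (max_le (hale 0) ?_)
          rw [map_zero]
          exact TMax.zero_le _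
        | succ k ih =>
          exact (abs_le_of_balances (hsq k) (hsq _) (hsa _) (hb1 k)).2.trans (max_le (hale _) ih)
      obtain ⟨k, hk⟩ := TMax.maxExponents_nonempty (map_abs_ne_zero hQ0) hr0'
      rw [TMax.mem_maxExponents (map_abs_ne_zero hQ0) hr0', ← abs_coeff_mul_pow] at hk
      rw [← hk, ← map_mul]
      exact hq k
  set M := abs r * (Q.map abs).eval (abs r) with hM
  have hM0 : M ≠ 0 := mul_ne_zero (mt abs_eq_zero.1 hr0) hB0
  have hα : (fun k => signAt M (lam * (P.coeff k * r ^ k))) =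
      fun k => signAt (abs lam) lam * signSeq r P k := by
    funext k
    rw [← hMeq]
    exact signAt_mul hlam (hsP k) hlam0 hA0
  have hκ : (fun k => signAt M (r * (Q.coeff k * r ^ k))) =
      fun k => signAt (abs r) r * signSeq r Q k := by
    funext k
    exact signAt_mul hr (hsQ k) hr0 hB0
  have hself : ∀ {s : SMax Γ}, IsSigned s → s ≠ 0 → signAt (abs s) s ≠ 0 := fun hs hs0 =>
    (signAt_ne_zero (mt abs_eq_zero.1 hs0) hs).2 rfl
  rw [hMeq] at hale
  have h0 := signDiff_of_balances hM0 isSigned_zero (hsq 0) (hsa 0)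
    (by rw [map_zero]; exact TMax.zero_le _) (hqle 0) (hale 0) hb0
  rw [show signAt M (0 : SMax Γ) = 0 by
    by_contra h
    exact hM0.symm ((map_zero abs).symm.trans ((signAt_ne_zero hM0 isSigned_zero).1 h))] at h0
  have h1 := fun k => signDiff_of_balances hM0 (hsq k) (hsq (k + 1)) (hsa (k + 1))
    (hqle k) (hqle _) (hale _) (hb1 k)
  obtain ⟨k, hk⟩ := TMax.maxExponents_nonempty (map_abs_ne_zero hQ0) (mt abs_eq_zero.1 hr0)
  have hkd := le_natDegree_of_mem_maxExponents hk
  -- The length exceeds both degrees: the quotient sequence has ended in zero, and every maximal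
  -- exponent of either polynomial is scanned.
  have hdesc := signScan_diff (κ := fun k => signAt M (r * (Q.coeff k * r ^ k)))
    (α := fun k => signAt M (lam * (P.coeff k * r ^ k))) (n := P.natDegree + Q.natDegree + 1)
    (k := k) h0 h1 (by omega)
    (by
      rw [congrFun hκ k]
      exact mul_ne_zero (hself hr hr0) ((signSeq_ne_zero hr hr0 hQ hQ0).2 hk))
    (by rw [coeff_eq_zero_of_natDegree_lt (by omega), zero_mul, mul_zero]
        by_contra h
        exact hM0.symm ((map_zero abs).symm.trans ((signAt_ne_zero hM0 isSigned_zero).1 h)))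
  rw [hα, hκ, signScan_mul (hself hlam hlam0), signScan_mul (hself hr hr0)] at hdesc
  rw [← variation_eq hr hr0 hP hP0 (n := P.natDegree + Q.natDegree + 1 + 1) fun k hk hk' => by
      have := le_natDegree_of_mem_maxExponents hk'
      omega,
    ← variation_eq hr hr0 hQ hQ0 (n := P.natDegree + Q.natDegree + 1 + 1) fun k hk hk' => by
      have := le_natDegree_of_mem_maxExponents hk'
      omega]
  exact hdesc

/-- Here the factor is `Y` itself, so wherever `Y Q` has a zero coefficient, the balance with a
signed element makes that of `P` vanish. -/
theorem IsQuotient.natTrailingDegree_lt {Q : (SMax Γ)[X]} (hP : IsSignedPoly P) (hP0 : P ≠ 0)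
    (h : IsQuotient 0 P Q) :
    (Q.map abs).natTrailingDegree + 1 ≤ (P.map abs).natTrailingDegree := by
  obtain ⟨hQ, lam, hlam, hlam0, hb⟩ := h
  refine le_natTrailingDegree (map_abs_ne_zero hP0) fun k hk => ?_
  rw [coeff_map, abs_eq_zero]
  have := hb k
  rw [neg_zero, C_0, add_zero, coeff_C_mul] at this
  suffices hz : (X * Q).coeff k = 0 by
    rw [hz] at this
    exact (mul_eq_zero_iff.1 (this.eq (hlam.mul (hP k)) isSigned_zero)).resolve_left hlam0
  cases k with
  | zero => exact coeff_X_mul_zero Q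
  | succ k =>
    rw [coeff_X_mul, ← abs_eq_zero, ← coeff_map]
    exact coeff_eq_zero_of_lt_natTrailingDegree (by omega)

/-- A function that decreases when a linear factor is divided out bounds the multiplicity. -/
theorem rootMult_le_of_quotient (V : (SMax Γ)[X] → ℕ)
    (hroot : ∀ P : (SMax Γ)[X], IsSignedPoly P → P ≠ 0 → IsSignedRoot P r → 1 ≤ V P)
    (hquot : ∀ P Q : (SMax Γ)[X], IsSignedPoly P → P ≠ 0 → IsQuotient r P Q → V Q + 1 ≤ V P)
    (hP : IsSignedPoly P) (hP0 : P ≠ 0) : rootMult r P ≤ V P := by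
  classical
  -- A least fixed point lies below every function that the recursion step does not increase. The
  -- value `⊤` off the nonzero signed polynomials makes the inequality trivial there.
  have h : rootMult r ≤ fun P => if IsSignedPoly P ∧ P ≠ 0 then (V P : ℕ∞) else ⊤ := by
    refine OrderHom.lfp_le _ fun P => ?_
    change (if IsSignedRoot P r then 1 + ⨆ Q : {Q // IsQuotient r P Q},
      (if IsSignedPoly Q.1 ∧ Q.1 ≠ 0 then (V Q.1 : ℕ∞) else ⊤) else 0) ≤
        if IsSignedPoly P ∧ P ≠ 0 then (V P : ℕ∞) else ⊤
    by_cases hs : IsSignedPoly P ∧ P ≠ 0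
    · rw [if_pos hs]
      split_ifs with hr
      · obtain ⟨w, hw⟩ := Nat.exists_eq_add_of_le (hroot P hs.1 hs.2 hr)
        rw [hw, Nat.cast_add, Nat.cast_one]
        refine add_le_add le_rfl (iSup_le fun Q => ?_)
        rw [if_pos ⟨Q.2.1, Q.2.ne_zero hs.1 hs.2⟩]
        have := hquot P Q hs.1 hs.2 Q.2
        exact_mod_cast (by omega : V Q ≤ w)
      · exact bot_le
    · rw [if_neg hs]
      exact le_top
  refine (h P).trans ?_
  simp only [if_pos (show IsSignedPoly P ∧ P ≠ 0 from ⟨hP, hP0⟩), le_refl]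

theorem rootMult_le_variation (hr : IsSigned r) (hr0 : r ≠ 0) (hP : IsSignedPoly P)
    (hP0 : P ≠ 0) : rootMult r P ≤ variation r P :=
  rootMult_le_of_quotient (variation r) (fun _ h h0 => one_le_variation h h0 hr0)
    (fun _ _ h h0 hq => hq.variation_lt hr hr0 h h0) hP hP0

theorem rootMult_zero_le (hP : IsSignedPoly P) (hP0 : P ≠ 0) :
    rootMult 0 P ≤ TMax.cornerMult (P.map abs) 0 := by
  rw [TMax.cornerMult, if_pos rfl]
  refine rootMult_le_of_quotient (fun P => (P.map abs).natTrailingDegree) (fun P h h0 hr => ?_)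
    (fun _ _ h h0 hq => hq.natTrailingDegree_lt h h0) hP hP0
  have hc := isCorner_of_root h h0 hr
  rw [TMax.IsCorner, if_pos (map_zero abs)] at hc
  have := map_abs_ne_zero h0
  rw [Nat.one_le_iff_ne_zero, Ne, natTrailingDegree_eq_zero]
  tauto

/-- The coefficient `a` is generalized so that one factor can be absorbed: `a (⊖ r)^(k+1) = ⊖(a r)
(⊖ r)^k`. -/
theorem signAt_mul_neg_pow {m : TMax Γ} (hm : m ≠ 0) (hr : IsSigned r) (k : ℕ) :
    ∀ {a : SMax Γ}, IsSigned a → signAt m (a * neg r ^ k) = (-1) ^ k * signAt m (a * r ^ k) := by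
  induction k with
  | zero => simp
  | succ k ih =>
    intro a ha
    have e : a * neg r ^ (k + 1) = neg (a * r) * neg r ^ k := by
      rw [pow_succ, mul_comm (neg r ^ k), ← mul_assoc, mul_comm a, neg_mul, mul_comm r]
    rw [e, ih (ha.mul hr).neg, neg_mul, signAt_neg hm ((ha.mul hr).mul (hr.pow k)), pow_succ,
      pow_succ, mul_comm (r ^ k), mul_assoc a]
    simp

/-- The sign sequence at `⊖ r` is the alternation of the one at `r`, and both are supported between
the extreme maximal exponents. -/
theorem variation_add_variation_neg_le (hr : IsSigned r) (hr0 : r ≠ 0) (hP : IsSignedPoly P)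
    (hP0 : P ≠ 0) :
    variation r P + variation (neg r) P ≤ TMax.cornerMult (P.map abs) (abs r) := by
  have hr0' := mt abs_eq_zero.1 hr0
  have hp0 := map_abs_ne_zero hP0
  have hnr0 : neg r ≠ 0 := fun h => hr0' (by rw [← abs_neg, h, map_zero])
  have hlo := TMax.sInf_mem_maxExponents hp0 hr0'
  have hle := TMax.le_sSup_maxExponents hlo
  have hseq : signSeq (neg r) P = fun k => (-1) ^ k * signSeq r P k := by
    funext k
    rw [signSeq, signSeq, abs_neg, signAt_mul_neg_pow (eval_abs_ne_zero hr0 hP0) hr k (hP k)]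
  have hn : ∀ k, sSup (TMax.maxExponents (P.map abs) (abs r) : Set ℕ) + 1 ≤ k →
      k ∉ TMax.maxExponents (P.map abs) (abs r) := fun k hk hk' => by
    have := TMax.le_sSup_maxExponents hk'
    omega
  have h := signScan_add_alternating_le (α := signSeq r P)
    (f := sInf (TMax.maxExponents (P.map abs) (abs r) : Set ℕ))
    (fun k hk => by
      by_contra hne
      have := TMax.sInf_maxExponents_le ((signSeq_ne_zero hr hr0 hP hP0).1 hne)
      omega)
    ((signSeq_ne_zero hr hr0 hP hP0).2 hlo)
    (sSup (TMax.maxExponents (P.map abs) (abs r) : Set ℕ) -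
      sInf (TMax.maxExponents (P.map abs) (abs r) : Set ℕ))
  rw [Nat.add_sub_cancel' hle, ← hseq, variation_eq hr hr0 hP hP0 hn,
    variation_eq hr.neg hnr0 hP hP0 (by rwa [abs_neg])] at h
  rwa [TMax.cornerMult, if_neg hr0']

theorem rootMult_add_rootMult_neg_le (hr : IsSigned r) (hr0 : r ≠ 0) (hP : IsSignedPoly P)
    (hP0 : P ≠ 0) :
    rootMult r P + rootMult (neg r) P ≤ TMax.cornerMult (P.map abs) (abs r) := by
  have hnr0 : neg r ≠ 0 := fun h =>
    hr0 (abs_eq_zero.1 (by rw [← abs_neg, h, map_zero]))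
  refine (add_le_add (rootMult_le_variation hr hr0 hP hP0)
    (rootMult_le_variation hr.neg hnr0 hP hP0)).trans ?_
  exact_mod_cast variation_add_variation_neg_le hr hr0 hP hP0

/-! ### Counting roots by absolute value -/

theorem IsSigned.eq_or_eq (hr : IsSigned r) : r = mk ⟨abs r, 0⟩ ∨ r = mk ⟨0, abs r⟩ := by
  obtain ⟨c, rfl | rfl⟩ := hr
  · exact Or.inl (by rw [abs_mk, max_eq_left (TMax.zero_le _)])
  · exact Or.inr (by rw [abs_mk, max_eq_right (TMax.zero_le _)])

theorem finite_setOf_isSignedRoot (hP : IsSignedPoly P) (hP0 : P ≠ 0) :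
    {r | IsSignedRoot P r}.Finite := by
  refine ((TMax.finite_setOf_isCorner (map_abs_ne_zero hP0)).biUnion
    fun c _ => Set.toFinite {mk ⟨c, 0⟩, mk ⟨0, c⟩}).subset fun r hr => ?_
  exact Set.mem_biUnion (isCorner_of_root hP hP0 hr) hr.1.eq_or_eq

/-- At most two signed elements have absolute value `c`. A singleton `s` gives the bound for one
root, and the fibres of `abs` give the total count. -/
theorem sum_rootMult_le_cornerMult (hP : IsSignedPoly P) (hP0 : P ≠ 0) (c : TMax Γ)
    {s : Finset (SMax Γ)} (hs : ∀ r ∈ s, IsSigned r ∧ abs r = c) :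
    ∑ r ∈ s, rootMult r P ≤ TMax.cornerMult (P.map abs) c := by
  classical
  by_cases hc : c = 0
  · subst hc
    have hsub : s ⊆ {0} := fun r hr => by simpa using abs_eq_zero.1 (hs r hr).2
    refine (Finset.sum_le_sum_of_subset hsub).trans ?_
    rw [Finset.sum_singleton]
    exact rootMult_zero_le hP hP0
  · have hsub : s ⊆ {mk ⟨c, 0⟩, mk ⟨0, c⟩} := fun r hr => by
      obtain ⟨h, rfl⟩ := hs r hr
      simpa using h.eq_or_eq
    refine (Finset.sum_le_sum_of_subset hsub).trans ?_
    have habs : abs (mk ⟨c, 0⟩ : SMax Γ) = c := by rw [abs_mk, max_eq_left (TMax.zero_le _)]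
    have h := rootMult_add_rootMult_neg_le (r := mk ⟨c, 0⟩) ⟨c, Or.inl rfl⟩
      (fun h => hc (by rw [← habs, h, map_zero])) hP hP0
    rw [habs] at h
    rwa [Finset.sum_pair fun h => hc (mk_pos_eq_mk_neg.1 h).1]

theorem sum_rootMult_le (hP : IsSignedPoly P) (hP0 : P ≠ 0) {s : Finset (SMax Γ)}
    (hs : ∀ r ∈ s, IsSigned r) : ∑ r ∈ s, rootMult r P ≤ P.natDegree := by
  classical
  -- Grouping by absolute value bounds the sum by a sum of corner multiplicities over distinct
  -- points.
  rw [← Finset.sum_fiberwise_of_maps_to (t := s.image abs) (g := abs)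
    fun r hr => Finset.mem_image_of_mem _ hr]
  refine (Finset.sum_le_sum fun c _ => sum_rootMult_le_cornerMult hP hP0 c
    (s := s.filter fun r => abs r = c) fun r hr => ?_).trans ?_
  · rw [Finset.mem_filter] at hr
    exact ⟨hs r hr.1, hr.2⟩
  · exact_mod_cast (TMax.sum_cornerMult_le (map_abs_ne_zero hP0) _).trans natDegree_map_le

end

end SMax

theorem mainTheorem8 {Γ : Type*} [AddCommGroup Γ] [LinearOrder Γ] [IsOrderedAddMonoid Γ]
    (hdiv : ∀ m : ℕ, 0 < m → ∀ g : Γ, ∃ h : Γ, m • h = g)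
    (P : (SMax Γ)[X]) (hP : SMax.IsSignedPoly P) (n : ℕ) (hn : P.degree = n) :
    (∀ r : SMax Γ, SMax.IsSignedRoot P r →
      TMax.IsCorner (P.map SMax.abs) (SMax.abs r) ∧
      SMax.rootMult r P ≤ TMax.cornerMult (P.map SMax.abs) (SMax.abs r)) ∧
    (∀ r : SMax Γ, SMax.IsSignedRoot P r → r ≠ 0 →
      SMax.rootMult r P + SMax.rootMult (SMax.neg r) P
        ≤ TMax.cornerMult (P.map SMax.abs) (SMax.abs r)) ∧
    ∃ hfin : {r : SMax Γ | SMax.IsSignedRoot P r}.Finite,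
      ∑ r ∈ hfin.toFinset, SMax.rootMult r P ≤ n := by
  have hP0 : P ≠ 0 := by
    rintro rfl
    simp at hn
  refine ⟨fun r hr => ⟨SMax.isCorner_of_root hP hP0 hr, ?_⟩,
    fun r hr hr0 => SMax.rootMult_add_rootMult_neg_le hr.1 hr0 hP hP0,
    SMax.finite_setOf_isSignedRoot hP hP0, ?_⟩
  · have := SMax.sum_rootMult_le_cornerMult hP hP0 (SMax.abs r) (s := {r})
      fun s hs => by rw [Finset.mem_singleton.1 hs]; exact ⟨hr.1, rfl⟩
    rwa [Finset.sum_singleton] at this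
  · rw [← natDegree_eq_of_degree_eq_some hn]
    exact SMax.sum_rootMult_le hP hP0 fun r hr => ((Set.Finite.mem_toFinset _).1 hr).1
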